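/- Matroids are finite, and a polymatroid $(E,\rho)$ is a finite set $E$ with a function $\rho:2^E\to\mathbb{Z}_{\ge 0}$ that is monotone, submodular and satisfies $\rho(\emptyset)=0$; it is a $k$-polymatroid if $\rho(\{e\})\le k$ for all $e\in E$. Minors of $\rho$ are obtained by deletion (restriction of $\rho$ to $E\setminus D$) and contraction ($X\mapsto\rho(X\cup C)-\rho(C)$ on $E\setminus C$); a minor is proper if it is not $\rho$ itself. The $k$-natural matroid $M_\rho^k$ of a $k$-polymatroid $\rho$ is obtained by replacing each $e\in E$ by a $k$-element set $X_e$ (these sets being pairwise disjoint): writing $X_A=\bigcup_{e\in A}X_e$, it is the matroid on $X_E$ with rank function $$r(X)=\min\{\rho(A)+|X\setminus X_A| : A\subseteq E\}.$$ For a class of matroids (closed under isomorphism), an excluded minor is a matroid that is not in the class although all its proper minors are. **Theorem.** Let $b\ge 4$, and let $\mathcal{C}$ be the minor-closed class of matroids whose excluded minors are, up to isomorphism, exactly the uniform matroids $U_{2,b}$ and $U_{b-2,b}$. Let $k\ge 2b-4$, and let $\mathcal{C}'_k$ be the class of $k$-polymatroids $\rho$ with $M_\rho^k\in\mathcal{C}$.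 Call a $k$-polymatroid an excluded minor for $\mathcal{C}'_k$ if it is not in $\mathcal{C}'_k$ but all its proper minors are. Then every excluded minor for $\mathcal{C}'_k$ has a ground set of at most $b$ elements, and, up to isomorphism, there are only finitely many excluded minors for $\mathcal{C}'_k$. -/

import Mathlib

universe u v

/-! ### Matroids: isomorphism, uniform matroids, classes and excluded minors -/

/-- Two matroids are isomorphic if some bijection of their ground sets preserves independence
in both directions. -/
def MatroidIso {α : Type u} {β : Type v} (M : Matroid α) (N : Matroid β) : Prop :=
  ∃ f : M.E ≃ N.E, ∀ I : Set M.E,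
    M.Indep (Subtype.val '' I) ↔ N.Indep (Subtype.val '' (f '' I))

/-- The uniform matroid `U_{r,n}` on `{0, …, n - 1}`: a set is independent iff it has at most `r`
elements. -/
def uniformMatroid (r n : ℕ) : Matroid (Fin n) :=
  (IndepMatroid.ofFinite (E := Set.univ) Set.finite_univ (fun I => I.ncard ≤ r)
    (by simp)
    (fun _ J hJ hIJ => (Set.ncard_le_ncard hIJ J.toFinite).trans hJ)
    (by
      intro I J _ hJ hlt
      obtain ⟨e, heJ, heI⟩ := Set.exists_mem_notMem_of_ncard_lt_ncard hlt I.toFinite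
      refine ⟨e, heJ, heI, ?_⟩
      rw [Set.ncard_insert_of_notMem heI I.toFinite]
      omega)
    (fun I _ => Set.subset_univ I)).matroid

/-- A class of finite matroids, closed under isomorphism. -/
structure MatroidClass where
  Mem : ∀ {α : Type u}, Matroid α → Prop
  finite : ∀ {α : Type u} {M : Matroid α}, Mem M → M.Finite
  iso : ∀ {α β : Type u} {M : Matroid α} {N : Matroid β}, MatroidIso M N → Mem M → Mem N

namespace MatroidClass

/-- The class contains every minor of each of its members. -/
def MinorClosed (C : MatroidClass.{u}) : Prop :=
  ∀ ⦃α : Type u⦄ ⦃M N : Matroid α⦄, C.Mem M → N.IsMinor M → C.Mem N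

/-- A finite matroid that is not in the class, while all its proper minors are. -/
def IsExcludedMinor (C : MatroidClass.{u}) {α : Type u} (M : Matroid α) : Prop :=
  M.Finite ∧ ¬ C.Mem M ∧ ∀ N : Matroid α, N.IsStrictMinor M → C.Mem N

end MatroidClass

/-! ### Polymatroids -/

/-- An (integer) polymatroid on a finite ground set: a normalized, monotone, submodular function
on the subsets of the ground set. As for `Matroid`, the ground set is a subset of an ambient type;
the value of `rk` at any set is its value at the intersection of that set with the ground set. -/
structure Polymatroid (α : Type u) where
  E : Set α
  finite : E.Finite
  rk : Set α → ℕ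
  rk_inter_ground : ∀ A, rk (A ∩ E) = rk A
  rk_empty : rk ∅ = 0
  rk_mono : ∀ ⦃A B⦄, A ⊆ B → rk A ≤ rk B
  rk_submod : ∀ A B, rk (A ∪ B) + rk (A ∩ B) ≤ rk A + rk B

namespace Polymatroid

variable {α : Type u} {β : Type v}

/-- `ρ` is a `k`-polymatroid if every element of the ground set has rank at most `k`. -/
def IsKPolymatroid (ρ : Polymatroid α) (k : ℕ) : Prop :=
  ∀ e ∈ ρ.E, ρ.rk {e} ≤ k

/-- The deletion `ρ ＼ D`: the restriction of `ρ` to `E - D`. -/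
def delete (ρ : Polymatroid α) (D : Set α) : Polymatroid α where
  E := ρ.E \ D
  finite := ρ.finite.subset Set.sdiff_subset
  rk X := ρ.rk (X \ D)
  rk_inter_ground A := by
    rw [← ρ.rk_inter_ground (A \ D)]
    congr 1
    ext x
    simp only [Set.mem_inter_iff, Set.mem_sdiff]
    tauto
  rk_empty := by simp [ρ.rk_empty]
  rk_mono A B h := ρ.rk_mono (Set.sdiff_subset_sdiff_left h)
  rk_submod A B := by
    have h := ρ.rk_submod (A \ D) (B \ D)
    have e : A \ D ∩ (B \ D) = (A ∩ B) \ D := by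
      ext x
      simp only [Set.mem_inter_iff, Set.mem_sdiff]
      tauto
    rwa [← Set.union_sdiff_distrib, e] at h

/-- The contraction `ρ ／ C`: the polymatroid on `E - C` with `X ↦ ρ(X ∪ C) - ρ(C)`. -/
def contract (ρ : Polymatroid α) (C : Set α) : Polymatroid α where
  E := ρ.E \ C
  finite := ρ.finite.subset Set.sdiff_subset
  rk X := ρ.rk (X ∪ C) - ρ.rk C
  rk_inter_ground A := by
    rw [← ρ.rk_inter_ground (A ∪ C), ← ρ.rk_inter_ground (A ∩ (ρ.E \ C) ∪ C)]
    congr 2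
    ext x
    simp only [Set.mem_inter_iff, Set.mem_union, Set.mem_sdiff]
    tauto
  rk_empty := by simp
  rk_mono A B h := Nat.sub_le_sub_right (ρ.rk_mono (Set.union_subset_union_left C h)) _
  rk_submod A B := by
    have h := ρ.rk_submod (A ∪ C) (B ∪ C)
    rw [← Set.union_union_distrib_right, ← Set.inter_union_distrib_right] at h
    have h1 := ρ.rk_mono (Set.subset_union_right : C ⊆ A ∪ C)
    have h2 := ρ.rk_mono (Set.subset_union_right : C ⊆ B ∪ C)
    have h3 := ρ.rk_mono (Set.subset_union_right : C ⊆ (A ∪ B) ∪ C)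
    have h4 := ρ.rk_mono (Set.subset_union_right : C ⊆ (A ∩ B) ∪ C)
    omega

/-- `σ` is a minor of `ρ` if it is obtained by a contraction followed by a deletion. -/
def IsMinor (σ ρ : Polymatroid α) : Prop :=
  ∃ C D : Set α, σ = (ρ.contract C).delete D

/-- A proper minor is a minor other than the polymatroid itself. -/
def IsProperMinor (σ ρ : Polymatroid α) : Prop :=
  σ.IsMinor ρ ∧ σ ≠ ρ

/-- Two polymatroids are isomorphic if some bijection of their ground sets preserves ranks. -/
def Iso (ρ : Polymatroid α) (σ : Polymatroid β) : Prop :=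
  ∃ f : ρ.E ≃ σ.E, ∀ A : Set ρ.E,
    σ.rk (Subtype.val '' (f '' A)) = ρ.rk (Subtype.val '' A)

/-! ### The `k`-natural matroid

Each `e` in the ground set is replaced by the `k`-element set `X_e = {e} × Fin k`; for `A ⊆ E`, the
union of the sets `X_e` with `e ∈ A` is `X_A = Prod.fst ⁻¹' A`. The `k`-natural matroid is the matroid
on `X_E` whose rank function is `r(X) = min {ρ(A) + |X - X_A| : A ⊆ E}`. -/

/-- Independence in the `k`-natural matroid: `|I ∩ X_A| ≤ ρ(A)` for all `A ⊆ E`. In terms of the rank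
function above this says `|I| ≤ r(I)`. -/
def NaturalIndep (ρ : Polymatroid α) (k : ℕ) (I : Set (α × Fin k)) : Prop :=
  I ⊆ Prod.fst ⁻¹' ρ.E ∧ ∀ A ⊆ ρ.E, (I ∩ Prod.fst ⁻¹' A).ncard ≤ ρ.rk A

theorem finite_preimage_ground (ρ : Polymatroid α) (k : ℕ) :
    (Prod.fst ⁻¹' ρ.E : Set (α × Fin k)).Finite := by
  have h := ρ.finite.prod (Set.finite_univ (α := Fin k))
  rwa [Set.prod_univ] at h

/-- If `|I ∩ X_A| ≤ ρ(A)` for all `A ⊆ E`, then there is a largest `T ⊆ E` attaining equality. -/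
theorem NaturalIndep.exists_max_tight {ρ : Polymatroid α} {k : ℕ} {I : Set (α × Fin k)}
    (hI : ρ.NaturalIndep k I) :
    ∃ T ⊆ ρ.E, (I ∩ Prod.fst ⁻¹' T).ncard = ρ.rk T ∧
      ∀ A ⊆ ρ.E, (I ∩ Prod.fst ⁻¹' A).ncard = ρ.rk A → A ⊆ T := by
  have hfin : I.Finite := (ρ.finite_preimage_ground k).subset hI.1
  have hS : {A | A ⊆ ρ.E ∧ (I ∩ Prod.fst ⁻¹' A).ncard = ρ.rk A}.Finite :=
    ρ.finite.finite_subsets.subset fun A hA => hA.1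
  obtain ⟨T, hT⟩ := hS.exists_maximal ⟨∅, Set.empty_subset _, by simp [ρ.rk_empty]⟩
  refine ⟨T, hT.prop.1, hT.prop.2, fun A hAE hA => ?_⟩
  refine Set.subset_union_right.trans
    (hT.le_of_ge (y := T ∪ A) ⟨Set.union_subset hT.prop.1 hAE, ?_⟩ Set.subset_union_left)
  have h1 := hI.2 (T ∪ A) (Set.union_subset hT.prop.1 hAE)
  have h2 := hI.2 (T ∩ A) (Set.inter_subset_left.trans hT.prop.1)
  have h3 := ρ.rk_submod T A
  have h4 := Set.ncard_union_add_ncard_inter (I ∩ Prod.fst ⁻¹' T) (I ∩ Prod.fst ⁻¹' A)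
    (hfin.subset Set.inter_subset_left) (hfin.subset Set.inter_subset_left)
  rw [← Set.inter_union_distrib_left, ← Set.inter_inter_distrib_left, ← Set.preimage_union,
    ← Set.preimage_inter] at h4
  have h5 := hT.prop.2
  omega

/-- If `e` cannot be added to an independent set, then it lies in `X_A` for some tight `A`. -/
theorem NaturalIndep.exists_tight_of_not_insert {ρ : Polymatroid α} {k : ℕ} {I : Set (α × Fin k)}
    (hI : ρ.NaturalIndep k I) {e : α × Fin k} (heE : e.1 ∈ ρ.E)
    (hne : ¬ ρ.NaturalIndep k (insert e I)) :
    ∃ A ⊆ ρ.E, (I ∩ Prod.fst ⁻¹' A).ncard = ρ.rk A ∧ e.1 ∈ A := by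
  by_contra! hcon
  refine hne ⟨Set.insert_subset heE hI.1, fun A hA => ?_⟩
  have hle := hI.2 A hA
  by_cases heA : e.1 ∈ A
  · have hlt : (I ∩ Prod.fst ⁻¹' A).ncard < ρ.rk A :=
      lt_of_le_of_ne hle fun h => hcon A hA h heA
    rw [Set.insert_inter_of_mem (by exact heA)]
    exact (Set.ncard_insert_le _ _).trans hlt
  · rwa [Set.insert_inter_of_notMem (by exact heA)]

/-- The `k`-natural matroid of `ρ`. -/
def naturalMatroid (ρ : Polymatroid α) (k : ℕ) : Matroid (α × Fin k) :=
  (IndepMatroid.ofFinite (ρ.finite_preimage_ground k) (ρ.NaturalIndep k)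
    ⟨Set.empty_subset _, by simp⟩
    (fun I J hJ hIJ => ⟨hIJ.trans hJ.1, fun A hA =>
      (Set.ncard_le_ncard (Set.inter_subset_inter_left _ hIJ)
        (((ρ.finite_preimage_ground k).subset hJ.1).subset Set.inter_subset_left)).trans
        (hJ.2 A hA)⟩)
    (by
      intro I J hI hJ hlt
      by_contra! hcon
      have hIfin : I.Finite := (ρ.finite_preimage_ground k).subset hI.1
      have hJfin : J.Finite := (ρ.finite_preimage_ground k).subset hJ.1
      obtain ⟨T, hTE, hT, hmax⟩ := hI.exists_max_tight
      have hsub : J \ Prod.fst ⁻¹' T ⊆ I \ Prod.fst ⁻¹' T := by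
        rintro e ⟨heJ, heT⟩
        refine ⟨?_, heT⟩
        by_contra heI
        obtain ⟨A, hAE, hA, heA⟩ :=
          hI.exists_tight_of_not_insert (hJ.1 heJ) (hcon e heJ heI)
        exact heT (hmax A hAE hA heA)
      have h1 := Set.ncard_le_ncard hsub (hIfin.subset Set.sdiff_subset)
      have h2 := hJ.2 T hTE
      have h3 := Set.ncard_inter_add_ncard_sdiff_eq_ncard I (Prod.fst ⁻¹' T) hIfin
      have h4 := Set.ncard_inter_add_ncard_sdiff_eq_ncard J (Prod.fst ⁻¹' T) hJfin
      omega)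
    (fun _ hI => hI.1)).matroid

theorem naturalMatroid_indep_iff (ρ : Polymatroid α) (k : ℕ) (I : Set (α × Fin k)) :
    (ρ.naturalMatroid k).Indep I ↔ ρ.NaturalIndep k I := Iff.rfl

/-- The rank function of the `k`-natural matroid is `r(X) = min {ρ(A) + |X - X_A| : A ⊆ E}`. -/
theorem naturalMatroid_rank (ρ : Polymatroid α) (k : ℕ) {X : Set (α × Fin k)}
    (hX : X ⊆ Prod.fst ⁻¹' ρ.E) :
    ∃ r : ℕ, (ρ.naturalMatroid k).eRk X = r ∧
      IsLeast {n | ∃ A ⊆ ρ.E, n = ρ.rk A + (X \ Prod.fst ⁻¹' A).ncard} r := by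
  have hXfin : X.Finite := (ρ.finite_preimage_ground k).subset hX
  obtain ⟨I, hIX⟩ := (ρ.naturalMatroid k).exists_isBasis X hX
  have hI : ρ.NaturalIndep k I := hIX.indep
  have hIfin : I.Finite := hXfin.subset hIX.subset
  refine ⟨I.ncard, ?_, ?_, ?_⟩
  · rw [← hIX.encard_eq_eRk, hIfin.cast_ncard_eq]
  · obtain ⟨T, hTE, hT, hmax⟩ := hI.exists_max_tight
    have hsub : X \ Prod.fst ⁻¹' T = I \ Prod.fst ⁻¹' T := by
      refine Set.Subset.antisymm ?_ (Set.sdiff_subset_sdiff_left hIX.subset)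
      rintro e ⟨heX, heT⟩
      refine ⟨?_, heT⟩
      by_contra heI
      have hne : ¬ ρ.NaturalIndep k (insert e I) := fun h =>
        heI (hIX.mem_of_insert_indep heX h)
      obtain ⟨A, hAE, hA, heA⟩ := hI.exists_tight_of_not_insert (hX heX) hne
      exact heT (hmax A hAE hA heA)
    refine ⟨T, hTE, ?_⟩
    rw [hsub, ← hT, Set.ncard_inter_add_ncard_sdiff_eq_ncard I _ hIfin]
  · rintro n ⟨A, hAE, rfl⟩
    have h1 := hI.2 A hAE
    have h2 := Set.ncard_le_ncard (Set.sdiff_subset_sdiff_left hIX.subset :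
      I \ Prod.fst ⁻¹' A ⊆ X \ Prod.fst ⁻¹' A) (hXfin.subset Set.sdiff_subset)
    have h3 := Set.ncard_inter_add_ncard_sdiff_eq_ncard I (Prod.fst ⁻¹' A) hIfin
    omega

/-! ### The class of `k`-polymatroids with `k`-natural matroid in `C` -/

/-- `ρ` is a `k`-polymatroid whose `k`-natural matroid is in `C`. -/
def InNaturalClass (C : MatroidClass.{u}) (k : ℕ) (ρ : Polymatroid α) : Prop :=
  ρ.IsKPolymatroid k ∧ C.Mem (ρ.naturalMatroid k)

/-- `ρ` is an excluded minor for the class of `k`-polymatroids whose `k`-natural matroids are in `C`: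
a `k`-polymatroid that is not in this class, while all its proper minors are. -/
def IsExcludedMinor (C : MatroidClass.{u}) (k : ℕ) (ρ : Polymatroid α) : Prop :=
  ρ.IsKPolymatroid k ∧ ¬ InNaturalClass C k ρ ∧
    ∀ σ : Polymatroid α, σ.IsProperMinor ρ → InNaturalClass C k σ

end Polymatroid

/-! ### Minors avoiding a set of rank or corank at most one, and minors of uniform restrictions. -/

namespace Matroid

variable {α : Type u} {β : Type v}

/-! Let `ρ` be an excluded minor with more than `b` elements. Its natural matroid `M` has a
`b`-element minor `N` outside the class, so some block `X_e` misses `N`. If `X_e` has rank or corank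
at most 1, the whole block can be contracted, or the whole block deleted, keeping `N` as a minor
(`IsMinor.of_eRk_le_one` and its dual). As `M / X_e` and `M \ X_e` are the natural matroids of `ρ /
e` and `ρ \ e`, this contradicts minimality.

So it suffices that `ρ(e) ≥ 2` forces corank at most 1. A one-element minor of rank `m` gives
`U_{m,k}`; since `k ≥ 2b - 4`, every `m` with `2 ≤ m ≤ k - 2` yields `U_{2,b}` or `U_{b-2,b}`. Hence
the marginal of `e` over any set is at most 1 or at least `k - 1` (`IsExcludedMinor.marginal`). Were
it to fall from high to low on adding some `f`, a two-element minor would contain a large forbidden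
uniform matroid (`not_mem_of_pair`). The marginal therefore stays high up to `E - e`, which is the
corank bound.

Finiteness follows because size and rank are bounded. -/

/-- Write `N = M / C \ D`. If `X ∩ C` consists of loops, contracting it is the same as deleting it.
Otherwise a nonloop of `X ∩ C` spans `X`, so `X ∩ D` becomes loops in `M / C` and may be contracted
instead. -/
theorem IsMinor.of_eRk_le_one {M N : Matroid α} {X : Set α} (hNM : N ≤m M) (hXE : X ⊆ M.E)
    (hX : M.eRk X ≤ 1) (hd : Disjoint X N.E) : N ≤m M ／ X ∨ N ≤m M ＼ X := by
  obtain ⟨C, D, hC, hD, hCD, rfl⟩ := hNM.exists_eq_contract_delete_disjoint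
  have hXCD : X ⊆ C ∪ D := by
    intro x hx
    by_contra h
    rw [Set.mem_union, not_or] at h
    exact Set.disjoint_left.1 hd hx ⟨⟨hXE hx, h.1⟩, h.2⟩
  by_cases hl : X ∩ C ⊆ M.loops
  · right
    refine ⟨C \ X, D, ?_⟩
    have h1 : X ∩ C ⊆ (M ／ (C \ X)).loops := by
      rw [contract_loops_eq]
      exact fun x hx => ⟨M.closure_subset_closure (Set.empty_subset _) (hl hx), fun h => h.2 hx.1⟩
    have h2 : M ／ C = M ／ (C \ X) ＼ (X ∩ C) := by
      rw [← contract_eq_delete_of_subset_loops h1, contract_contract, Set.inter_comm,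
        Set.sdiff_union_inter]
    rw [h2, delete_contract_comm']
    rw [delete_delete, delete_delete]
    have h4 : (C \ X) \ X = C \ X := by ext; simp
    have h5 : X ∩ C ∪ D = X ∪ D := by
      ext x
      have := @hXCD x
      simp only [Set.mem_union, Set.mem_inter_iff] at this ⊢
      tauto
    rw [h4, h5]
  · left
    obtain ⟨x, ⟨hxX, hxC⟩, hxl⟩ := Set.not_subset.1 hl
    have hnl : M.IsNonloop x := (isNonloop_iff_notMem_loops (hXE hxX)).2 hxl
    have hcl : X ⊆ M.closure C := by
      have hb : M.IsBasis {x} X := by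
        refine (indep_singleton.2 hnl).isBasis_of_eRk_ge (Set.finite_singleton x)
          (Set.singleton_subset_iff.2 hxX) ?_ hXE
        rwa [hnl.eRk_eq]
      exact hb.subset_closure.trans (M.closure_subset_closure (Set.singleton_subset_iff.2 hxC))
    have h1 : X ∩ D ⊆ (M ／ C).loops := by
      rw [contract_loops_eq]
      exact fun y hy => ⟨hcl hy.1, fun h => Set.disjoint_left.1 hCD h hy.2⟩
    refine ⟨C \ X, D \ X, ?_⟩
    rw [contract_contract, ← Set.inter_union_sdiff D X, ← delete_delete, Set.inter_comm D X,
      ← contract_eq_delete_of_subset_loops h1, contract_contract]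
    have h5 : C ∪ X ∩ D = X ∪ C \ X := by
      ext y
      have := @hXCD y
      simp only [Set.mem_union, Set.mem_inter_iff, Set.mem_sdiff] at this ⊢
      tauto
    have h6 : (X ∩ D ∪ D \ X) \ X = D \ X := by ext; simp; tauto
    rw [h5, h6]

theorem IsMinor.dual {M N : Matroid α} (h : N ≤m M) : N✶ ≤m M✶ := by
  obtain ⟨C, D, hC, hD, hCD, rfl⟩ := h.exists_eq_contract_delete_disjoint
  exact ⟨D, C, by rw [dual_contract_delete, contract_delete_comm _ hCD.symm]⟩

theorem IsMinor.of_eRk_dual_le_one {M N : Matroid α} {X : Set α} (hNM : N ≤m M) (hXE : X ⊆ M.E)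
    (hX : M✶.eRk X ≤ 1) (hd : Disjoint X N.E) : N ≤m M ／ X ∨ N ≤m M ＼ X := by
  rcases hNM.dual.of_eRk_le_one hXE hX hd with h | h
  · right
    simpa using h.dual
  · left
    simpa using h.dual

/-- The restriction to `X` is uniform of rank `m`: contract `m - r` of its elements and keep `n` of
the others. -/
theorem exists_isMinor_matroidIso_uniform {M : Matroid α} {X : Set α} {m r n : ℕ}
    (hX : X.Finite) (hXE : X ⊆ M.E) (hI : ∀ I ⊆ X, M.Indep I ↔ I.ncard ≤ m) (hrm : r ≤ m)
    (hn : m + n ≤ X.ncard + r) :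
    ∃ N, N ≤m M ∧ MatroidIso N (uniformMatroid r n) := by
  obtain ⟨Y, hYX, hY⟩ := Set.exists_subset_card_eq (s := X) (n := m - r) (by omega)
  have hYfin := hX.subset hYX
  have hdiff := Set.ncard_sdiff_add_ncard_of_subset hYX hX
  obtain ⟨Z, hZX, hZ⟩ := Set.exists_subset_card_eq (s := X \ Y) (n := n) (by omega)
  have hZfin : Z.Finite := hX.subset (hZX.trans Set.sdiff_subset)
  have hYI : M.Indep Y := (hI Y hYX).2 (by omega)
  have hZE : Z ⊆ (M ／ Y).E := hZX.trans (Set.sdiff_subset_sdiff_left hXE)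
  have hind : ∀ I ⊆ Z, (M ／ Y).Indep I ↔ I.ncard ≤ r := by
    intro I hIZ
    have hdj : Disjoint I Y := Set.disjoint_left.2 fun x hx => (hZX (hIZ hx)).2
    rw [hYI.contract_indep_iff, and_iff_right (by exact hdj),
      hI _ (Set.union_subset ((hIZ.trans hZX).trans Set.sdiff_subset) hYX),
      Set.ncard_union_eq hdj (hZfin.subset hIZ) hYfin]
    omega
  refine ⟨(M ／ Y) ↾ Z, ?_, ?_⟩
  · rw [← delete_compl hZE]
    exact contract_delete_isMinor _ _ _
  · have hcard : Nat.card Z = n := hZ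
    have : Finite Z := hZfin
    let f : Z ≃ Fin n := Finite.equivFinOfCardEq hcard
    let g : ((M ／ Y) ↾ Z).E ≃ (uniformMatroid r n).E := f.trans (Equiv.Set.univ (Fin n)).symm
    refine ⟨g, fun I => ?_⟩
    have hIZ : Subtype.val '' I ⊆ Z := by
      rintro _ ⟨x, _, rfl⟩
      exact x.2
    rw [restrict_indep_iff, and_iff_left hIZ, hind _ hIZ]
    change _ ↔ (Subtype.val '' (g '' I)).ncard ≤ r
    rw [Set.ncard_image_of_injective _ Subtype.val_injective,
      Set.ncard_image_of_injective _ Subtype.val_injective,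
      Set.ncard_image_of_injective _ g.injective]

end Matroid

theorem MatroidIso.ncard_eq_of_uniform {α : Type u} {N : Matroid α} {r n : ℕ}
    (h : MatroidIso N (uniformMatroid r n)) : N.E.ncard = n := by
  obtain ⟨f, -⟩ := h
  rw [← Nat.card_coe_set_eq, Nat.card_congr f]
  change Nat.card (Set.univ : Set (Fin n)) = n
  simp

theorem MatroidClass.exists_isExcludedMinor {α : Type u} {C : MatroidClass.{u}} {M : Matroid α}
    (hM : M.Finite) (h : ¬ C.Mem M) : ∃ N, N.IsMinor M ∧ C.IsExcludedMinor N := by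
  induction hn : M.E.ncard using Nat.strong_induction_on generalizing M with
  | _ n ih =>
    by_cases hM' : C.IsExcludedMinor M
    · exact ⟨M, Matroid.IsMinor.refl, hM'⟩
    · simp only [MatroidClass.IsExcludedMinor, hM, h, true_and, not_false_iff, not_forall] at hM'
      obtain ⟨N, hNM, hN⟩ := hM'
      obtain ⟨N', h1, h2⟩ := ih N.E.ncard
        (hn ▸ Set.ncard_lt_ncard hNM.ssubset hM.ground_finite)
        ⟨hM.ground_finite.subset hNM.ssubset.subset⟩ hN rfl
      exact ⟨N', h1.trans hNM.isMinor, h2⟩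
-- Ranks and minors of the natural matroid.
namespace Polymatroid

variable {α : Type u} {β : Type v} {ρ : Polymatroid α} {k : ℕ}

theorem ncard_preimage_fst (A : Set α) : (Prod.fst ⁻¹' A : Set (α × Fin k)).ncard = A.ncard * k := by
  rw [← Set.prod_univ, Set.ncard_prod, Set.ncard_univ, Nat.card_fin]

theorem rk_union_le (ρ : Polymatroid α) (A B : Set α) : ρ.rk (A ∪ B) ≤ ρ.rk A + ρ.rk B :=
  (Nat.le_add_right _ _).trans (ρ.rk_submod A B)

theorem IsKPolymatroid.rk_le (hk : ρ.IsKPolymatroid k) {A : Set α} (hA : A ⊆ ρ.E) :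
    ρ.rk A ≤ A.ncard * k := by
  induction A, ρ.finite.subset hA using Set.Finite.induction_on with
  | empty => simp [ρ.rk_empty]
  | @insert a s has hs ih =>
    have h1 := ih ((Set.subset_insert _ _).trans hA)
    have h2 := hk a (hA (Set.mem_insert _ _))
    have h3 := ρ.rk_union_le {a} s
    rw [Set.singleton_union] at h3
    rw [Set.ncard_insert_of_notMem has hs, add_mul]
    omega

theorem IsKPolymatroid.delete (hk : ρ.IsKPolymatroid k) (D : Set α) :
    (ρ.delete D).IsKPolymatroid k :=
  fun e he => (ρ.rk_mono Set.sdiff_subset).trans (hk e he.1)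

theorem IsKPolymatroid.contract (hk : ρ.IsKPolymatroid k) (C : Set α) :
    (ρ.contract C).IsKPolymatroid k := by
  intro e he
  have h1 := ρ.rk_union_le {e} C
  have h2 := hk e he.1
  change ρ.rk ({e} ∪ C) - ρ.rk C ≤ k
  omega

theorem naturalMatroid_ground (ρ : Polymatroid α) (k : ℕ) :
    (ρ.naturalMatroid k).E = Prod.fst ⁻¹' ρ.E := rfl

theorem naturalMatroid_finite (ρ : Polymatroid α) (k : ℕ) : (ρ.naturalMatroid k).Finite :=
  ⟨ρ.finite_preimage_ground k⟩

/-- The bound `k` makes `A` itself a minimizer: `ρ(A) ≤ ρ(B) + k|A - B|` for every `B`. -/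
theorem IsKPolymatroid.eRk_preimage (hk : ρ.IsKPolymatroid k) {A : Set α} (hA : A ⊆ ρ.E) :
    (ρ.naturalMatroid k).eRk (Prod.fst ⁻¹' A) = ρ.rk A := by
  obtain ⟨r, hr, ⟨B, hB, hrB⟩, hle⟩ :=
    ρ.naturalMatroid_rank k (X := Prod.fst ⁻¹' A) (Set.preimage_mono hA)
  have h1 : r ≤ ρ.rk A := hle ⟨A, hA, by simp⟩
  have h2 : ρ.rk A ≤ r := by
    rw [hrB, ← Set.preimage_sdiff, ncard_preimage_fst]
    have h3 := hk.rk_le (A := A \ B) (Set.sdiff_subset.trans hA)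
    have h4 := ρ.rk_union_le B (A \ B)
    have h5 := ρ.rk_mono (Set.subset_union_right : A ⊆ B ∪ A)
    rw [Set.union_sdiff_self] at h4
    omega
  rw [hr, le_antisymm h1 h2]

theorem naturalMatroid_delete (ρ : Polymatroid α) (k : ℕ) (D : Set α) :
    (ρ.delete D).naturalMatroid k = (ρ.naturalMatroid k).delete (Prod.fst ⁻¹' D) := by
  refine Matroid.ext_indep rfl fun I hI => ?_
  have hI' : I ⊆ Prod.fst ⁻¹' (ρ.E \ D) := hI
  have hdj : Disjoint I (Prod.fst ⁻¹' D) := Set.disjoint_left.2 fun x hx => (hI' hx).2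
  rw [Matroid.delete_indep_iff, and_iff_left hdj, naturalMatroid_indep_iff,
    naturalMatroid_indep_iff]
  constructor
  · intro h
    refine ⟨fun x hx => (hI' hx).1, fun A hA => ?_⟩
    have h1 := h.2 (A \ D) (Set.sdiff_subset_sdiff_left hA)
    have h2 : I ∩ Prod.fst ⁻¹' (A \ D) = I ∩ Prod.fst ⁻¹' A := by
      rw [Set.preimage_sdiff, Set.inter_sdiff_distrib_left, hdj.inter_eq, Set.sdiff_empty]
    rw [h2] at h1
    exact h1.trans (ρ.rk_mono (Set.sdiff_subset.trans Set.sdiff_subset))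
  · intro h
    refine ⟨hI, fun A hA => ?_⟩
    have h1 := h.2 A (hA.trans Set.sdiff_subset)
    have h2 : A \ D = A := sdiff_eq_left.2 (Set.disjoint_left.2 fun x hx => (hA hx).2)
    change _ ≤ ρ.rk (A \ D)
    rwa [h2]

theorem contract_inter_ground (ρ : Polymatroid α) (C : Set α) :
    ρ.contract (C ∩ ρ.E) = ρ.contract C := by
  have h : ∀ A, ρ.rk (A ∪ C ∩ ρ.E) = ρ.rk (A ∪ C) := fun A => by
    rw [← ρ.rk_inter_ground (A ∪ C), ← ρ.rk_inter_ground (A ∪ C ∩ ρ.E)]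
    congr 1
    ext
    simp only [Set.mem_inter_iff, Set.mem_union]
    tauto
  simp only [contract, h, ρ.rk_inter_ground, Polymatroid.mk.injEq, and_true]
  ext
  simp only [Set.mem_inter_iff, Set.mem_sdiff]
  tauto

/-- A basis `J` of `X_C` has exactly `ρ(C)` elements, so the constraint for `I ∪ J` at `A ∪ C` is
that of `ρ / C` at `A`. Conversely, the constraints at `A - C` and `A ∩ C` combine by submodularity
into the one at `A`. -/
theorem IsKPolymatroid.naturalMatroid_contract_of_subset (hk : ρ.IsKPolymatroid k) {C : Set α}
    (hC : C ⊆ ρ.E) :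
    (ρ.contract C).naturalMatroid k = (ρ.naturalMatroid k).contract (Prod.fst ⁻¹' C) := by
  refine Matroid.ext_indep rfl fun I hI => ?_
  have hI' : I ⊆ Prod.fst ⁻¹' (ρ.E \ C) := hI
  have hIfin : I.Finite := (ρ.finite_preimage_ground k).subset fun x hx => (hI' hx).1
  have hdj : Disjoint (Prod.fst ⁻¹' C) I := Set.disjoint_right.2 fun x hx => (hI' hx).2
  obtain ⟨J, hJ⟩ := (ρ.naturalMatroid k).exists_isBasis (Prod.fst ⁻¹' C) (Set.preimage_mono hC)
  have hJfin : J.Finite := (ρ.finite_preimage_ground k).subset hJ.indep.subset_ground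
  have hJcard : J.ncard = ρ.rk C := by
    have h := hJ.encard_eq_eRk
    rw [hk.eRk_preimage hC, ← hJfin.cast_ncard_eq] at h
    exact_mod_cast h
  have hIJ : Disjoint I J := (hdj.mono_left hJ.subset).symm
  have hcard : ∀ A : Set α, ((I ∪ J) ∩ Prod.fst ⁻¹' A).ncard =
      (I ∩ Prod.fst ⁻¹' A).ncard + (J ∩ Prod.fst ⁻¹' A).ncard := fun A => by
    rw [Set.union_inter_distrib_right, Set.ncard_union_eq
      (hIJ.mono Set.inter_subset_left Set.inter_subset_left)
      (hIfin.subset Set.inter_subset_left) (hJfin.subset Set.inter_subset_left)]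
  rw [hJ.contract_indep_iff, and_iff_left hdj, naturalMatroid_indep_iff, naturalMatroid_indep_iff]
  constructor
  · intro h
    refine ⟨Set.union_subset (fun x hx => (hI' hx).1) hJ.indep.subset_ground, fun A hA => ?_⟩
    have h1 := h.2 (A \ C) (Set.sdiff_subset_sdiff_left hA)
    change _ ≤ ρ.rk (A \ C ∪ C) - ρ.rk C at h1
    have h2 : I ∩ Prod.fst ⁻¹' (A \ C) = I ∩ Prod.fst ⁻¹' A := by
      rw [Set.preimage_sdiff, Set.inter_sdiff_distrib_left, hdj.symm.inter_eq, Set.sdiff_empty]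
    have h3 := hJ.indep.2 (A ∩ C) (Set.inter_subset_left.trans hA)
    have h4 : J ∩ Prod.fst ⁻¹' (A ∩ C) = J ∩ Prod.fst ⁻¹' A := by
      rw [Set.preimage_inter, Set.inter_comm (Prod.fst ⁻¹' A), ← Set.inter_assoc,
        Set.inter_eq_left.2 hJ.subset]
    have h5 := ρ.rk_submod A C
    have h6 := ρ.rk_mono (Set.subset_union_right : C ⊆ A ∪ C)
    rw [h2, Set.sdiff_union_self] at h1
    rw [h4] at h3
    rw [hcard]
    omega
  · intro h
    refine ⟨hI, fun A hA => ?_⟩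
    have h1 := h.2 (A ∪ C) (Set.union_subset (hA.trans Set.sdiff_subset) hC)
    have h2 : I ∩ Prod.fst ⁻¹' (A ∪ C) = I ∩ Prod.fst ⁻¹' A := by
      rw [Set.preimage_union, Set.inter_union_distrib_left, hdj.symm.inter_eq, Set.union_empty]
    have h3 : J ∩ Prod.fst ⁻¹' (A ∪ C) = J :=
      Set.inter_eq_left.2 (hJ.subset.trans (Set.preimage_mono Set.subset_union_right))
    rw [hcard, h2, h3, hJcard] at h1
    change _ ≤ ρ.rk (A ∪ C) - ρ.rk C
    omega

theorem IsKPolymatroid.naturalMatroid_contract (hk : ρ.IsKPolymatroid k) (C : Set α) :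
    (ρ.contract C).naturalMatroid k = (ρ.naturalMatroid k).contract (Prod.fst ⁻¹' C) := by
  rw [← contract_inter_ground, hk.naturalMatroid_contract_of_subset Set.inter_subset_right,
    Set.preimage_inter, ← naturalMatroid_ground, Matroid.contract_inter_ground_eq]

/-- The corank of `X_e` is `k + ρ(E - e) - ρ(E)`. -/
theorem IsKPolymatroid.eRk_dual_preimage_singleton_le (hk : ρ.IsKPolymatroid k) {e : α}
    (he : e ∈ ρ.E) (h : ρ.rk (ρ.E \ {e}) + k ≤ ρ.rk ρ.E + 1) :
    (ρ.naturalMatroid k)✶.eRk (Prod.fst ⁻¹' {e}) ≤ 1 := by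
  have hsub : (Prod.fst ⁻¹' {e} : Set (α × Fin k)) ⊆ (ρ.naturalMatroid k).E :=
    Set.preimage_mono (Set.singleton_subset_iff.2 he)
  have hfin : (Prod.fst ⁻¹' {e} : Set (α × Fin k)).Finite :=
    (ρ.finite_preimage_ground k).subset hsub
  have h1 := (ρ.naturalMatroid k).eRk_dual_add_eRank _ hsub
  rw [← Matroid.eRk_ground, naturalMatroid_ground, hk.eRk_preimage Set.Subset.rfl,
    ← Set.preimage_sdiff, hk.eRk_preimage Set.sdiff_subset, ← hfin.cast_ncard_eq,
    ncard_preimage_fst, Set.ncard_singleton, one_mul] at h1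
  have h2 : (ρ.rk (ρ.E \ {e}) : ℕ∞) + k ≤ 1 + ρ.rk ρ.E := by
    rw [add_comm 1]
    exact_mod_cast h
  rw [← h1] at h2
  exact (ENat.add_le_add_iff_right (ENat.natCast_ne_top _)).1 h2

end Polymatroid

/-- The excluded minors of `C` are, up to isomorphism, `U_{2,b}` and `U_{b-2,b}`. -/
def MatroidClass.ExcludesUniform (C : MatroidClass.{u}) (b : ℕ) : Prop :=
  ∀ (α : Type u) (M : Matroid α), C.IsExcludedMinor M ↔
    (MatroidIso M (uniformMatroid 2 b) ∨ MatroidIso M (uniformMatroid (b - 2) b))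

theorem MatroidClass.ExcludesUniform.not_mem {α : Type u} {C : MatroidClass.{u}} {b : ℕ}
    (hEx : C.ExcludesUniform b) (hC : C.MinorClosed) {M : Matroid α} {X : Set α} {m : ℕ}
    (hX : X.Finite) (hXE : X ⊆ M.E) (hI : ∀ I ⊆ X, M.Indep I ↔ I.ncard ≤ m)
    (hm : (b - 2 ≤ m ∧ m + 2 ≤ X.ncard) ∨ (2 ≤ m ∧ m + b ≤ X.ncard + 2)) : ¬ C.Mem M := by
  intro hM
  obtain ⟨N, hNM, hN⟩ : ∃ N, N.IsMinor M ∧ C.IsExcludedMinor N := by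
    rcases hm with hm | hm
    · obtain ⟨N, h1, h2⟩ := Matroid.exists_isMinor_matroidIso_uniform (r := b - 2) (n := b)
        hX hXE hI hm.1 (by omega)
      exact ⟨N, h1, (hEx _ N).2 (Or.inr h2)⟩
    · obtain ⟨N, h1, h2⟩ := Matroid.exists_isMinor_matroidIso_uniform (r := 2) (n := b)
        hX hXE hI hm.1 hm.2
      exact ⟨N, h1, (hEx _ N).2 (Or.inl h2)⟩
  exact hN.2.1 (hC hM hNM)

/-! ### One- and two-element minors, the size bound, and finiteness. -/

namespace Polymatroid

variable {α : Type u} {β : Type v} {ρ σ : Polymatroid α} {b k : ℕ} {C : MatroidClass.{u}} {e f : α}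

theorem rk_singleton_of_mem (hEx : C.ExcludesUniform b) (hC : C.MinorClosed) (hk : 2 * b - 4 ≤ k)
    (hσ : σ.E = {e}) (hM : C.Mem (σ.naturalMatroid k)) : σ.rk {e} ≤ 1 ∨ k ≤ σ.rk {e} + 1 := by
  by_contra! hcon
  have hfin := σ.finite_preimage_ground k
  have hX : (Prod.fst ⁻¹' σ.E : Set (α × Fin k)).ncard = k := by
    rw [hσ, ncard_preimage_fst, Set.ncard_singleton, one_mul]
  refine hEx.not_mem hC (m := σ.rk {e}) hfin Set.Subset.rfl (fun I hI => ?_)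
    (by rw [hX]; omega) hM
  rw [naturalMatroid_indep_iff]
  constructor
  · intro h
    have := h.2 σ.E Set.Subset.rfl
    rwa [Set.inter_eq_left.2 hI, hσ] at this
  · intro h
    refine ⟨hI, fun A hA => ?_⟩
    rw [hσ] at hA
    rcases Set.subset_singleton_iff_eq.1 hA with rfl | rfl
    · simp
    · exact (Set.ncard_le_ncard Set.inter_subset_left (hfin.subset hI)).trans h

theorem not_mem_of_pair (hEx : C.ExcludesUniform b) (hC : C.MinorClosed) (hb : 4 ≤ b)
    (hk : 2 * b - 4 ≤ k) (hkσ : σ.IsKPolymatroid k) (hef : e ≠ f) (hσ : σ.E = {e, f})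
    (he : k ≤ σ.rk {e} + 1) (hf : k ≤ σ.rk {f} + 1)
    (hte : σ.rk {e, f} ≤ σ.rk {e} + 1) (htf : σ.rk {e, f} ≤ σ.rk {f} + 1) :
    ¬ C.Mem (σ.naturalMatroid k) := by
  have heE : e ∈ σ.E := by simp [hσ]
  have hfE : f ∈ σ.E := by simp [hσ]
  have hcard : ∀ x : α, (Prod.fst ⁻¹' {x} : Set (α × Fin k)).ncard = k := fun x => by
    rw [ncard_preimage_fst, Set.ncard_singleton, one_mul]
  -- Taking only `σ(e)` and `σ(f)` elements of the two blocks makes the singleton constraints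
  -- automatic; only the total rank binds, so the restriction is uniform.
  obtain ⟨P, hP, hPc⟩ := Set.exists_subset_card_eq (s := (Prod.fst ⁻¹' {e} : Set (α × Fin k)))
    (n := σ.rk {e}) (by rw [hcard]; exact hkσ e heE)
  obtain ⟨Q, hQ, hQc⟩ := Set.exists_subset_card_eq (s := (Prod.fst ⁻¹' {f} : Set (α × Fin k)))
    (n := σ.rk {f}) (by rw [hcard]; exact hkσ f hfE)
  have hfin := σ.finite_preimage_ground k
  have hPE : P ⊆ Prod.fst ⁻¹' σ.E :=
    hP.trans (Set.preimage_mono (Set.singleton_subset_iff.2 heE))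
  have hQE : Q ⊆ Prod.fst ⁻¹' σ.E :=
    hQ.trans (Set.preimage_mono (Set.singleton_subset_iff.2 hfE))
  have hX : (P ∪ Q).Finite := hfin.subset (Set.union_subset hPE hQE)
  have hPQ : Disjoint P Q := by
    refine Set.disjoint_left.2 fun x hx hx' => hef ?_
    rw [← show x.1 = e from hP hx, ← show x.1 = f from hQ hx']
  have hXc : (P ∪ Q).ncard = σ.rk {e} + σ.rk {f} := by
    rw [Set.ncard_union_eq hPQ (hfin.subset hPE) (hfin.subset hQE), hPc, hQc]
  have hmono : σ.rk {e} ≤ σ.rk {e, f} := σ.rk_mono (by simp)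
  refine hEx.not_mem hC (m := σ.rk {e, f}) hX (Set.union_subset hPE hQE) (fun I hI => ?_)
    (by rw [hXc]; omega)
  have hIfin := hX.subset hI
  have hIE : I ⊆ Prod.fst ⁻¹' σ.E := hI.trans (Set.union_subset hPE hQE)
  rw [naturalMatroid_indep_iff]
  constructor
  · intro h
    have := h.2 σ.E Set.Subset.rfl
    rwa [Set.inter_eq_left.2 hIE, hσ] at this
  · intro h
    refine ⟨hIE, fun A hA => ?_⟩
    rw [hσ] at hA
    rcases Set.subset_pair_iff_eq.1 hA with rfl | rfl | rfl | rfl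
    · simp
    · rw [← hPc]
      refine Set.ncard_le_ncard (fun x hx => (hI hx.1).resolve_right fun hxQ => hef ?_)
        (hfin.subset hPE)
      rw [← show x.1 = e from hx.2, ← show x.1 = f from hQ hxQ]
    · rw [← hQc]
      refine Set.ncard_le_ncard (fun x hx => (hI hx.1).resolve_left fun hxP => hef ?_)
        (hfin.subset hQE)
      rw [← show x.1 = e from hP hxP, ← show x.1 = f from hx.2]
    · exact (Set.ncard_le_ncard Set.inter_subset_left hIfin).trans h

/-- The minor of `ρ` on `S` obtained by contracting `A` and deleting everything else. -/
def restrictContract (ρ : Polymatroid α) (A S : Set α) : Polymatroid α :=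
  (ρ.contract A).delete Sᶜ

theorem restrictContract_ground {A S : Set α} (hS : S ⊆ ρ.E) (hSA : Disjoint S A) :
    (ρ.restrictContract A S).E = S := by
  ext x
  change (x ∈ ρ.E ∧ x ∉ A) ∧ ¬ ¬ x ∈ S ↔ x ∈ S
  rw [not_not]
  exact ⟨fun h => h.2, fun h => ⟨⟨hS h, Set.disjoint_left.1 hSA h⟩, h⟩⟩

theorem restrictContract_rk {A S T : Set α} (hT : T ⊆ S) :
    (ρ.restrictContract A S).rk T = ρ.rk (T ∪ A) - ρ.rk A := by
  change ρ.rk (T \ Sᶜ ∪ A) - ρ.rk A = _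
  rw [Set.sdiff_compl, Set.inter_eq_left.2 hT]

theorem IsExcludedMinor.mem_restrictContract (h : ρ.IsExcludedMinor C k) {A S : Set α}
    (hS : S ⊆ ρ.E) (hSA : Disjoint S A) (hne : S ≠ ρ.E) :
    C.Mem ((ρ.restrictContract A S).naturalMatroid k) :=
  (h.2.2 _ ⟨⟨A, Sᶜ, rfl⟩, fun heq => hne
    ((restrictContract_ground hS hSA).symm.trans (congrArg E heq))⟩).2

theorem IsExcludedMinor.marginal (h : ρ.IsExcludedMinor C k) (hEx : C.ExcludesUniform b)
    (hC : C.MinorClosed) (hk : 2 * b - 4 ≤ k) (hE : 2 ≤ ρ.E.ncard) (he : e ∈ ρ.E) {A : Set α}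
    (heA : e ∉ A) :
    ρ.rk (insert e A) ≤ ρ.rk A + 1 ∨ k + ρ.rk A ≤ ρ.rk (insert e A) + 1 := by
  have hS : {e} ⊆ ρ.E := Set.singleton_subset_iff.2 he
  have hSA : Disjoint {e} A := Set.disjoint_singleton_left.2 heA
  have h1 := rk_singleton_of_mem hEx hC hk (restrictContract_ground hS hSA)
    (h.mem_restrictContract hS hSA (by rintro heq; simp [← heq] at hE))
  rw [restrictContract_rk Set.Subset.rfl, Set.singleton_union] at h1
  have h2 := ρ.rk_mono (Set.subset_insert e A)
  omega

/-- Induction on `A`, using the gap between low and high marginals. Three elements are required so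
that minors on a pair are proper. -/
theorem IsExcludedMinor.marginal_of_two_le (h : ρ.IsExcludedMinor C k)
    (hEx : C.ExcludesUniform b) (hC : C.MinorClosed) (hb : 4 ≤ b) (hk : 2 * b - 4 ≤ k)
    (hE : 3 ≤ ρ.E.ncard) (he : e ∈ ρ.E) (h2 : 2 ≤ ρ.rk {e}) {A : Set α} (hA : A ⊆ ρ.E \ {e}) :
    k + ρ.rk A ≤ ρ.rk (insert e A) + 1 := by
  have hmarg : ∀ {e : α} {A : Set α}, e ∈ ρ.E → e ∉ A →
      ρ.rk (insert e A) ≤ ρ.rk A + 1 ∨ k + ρ.rk A ≤ ρ.rk (insert e A) + 1 :=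
    fun he heA => h.marginal hEx hC hk (by omega) he heA
  have hAfin : A.Finite := ρ.finite.subset (hA.trans Set.sdiff_subset)
  induction A, hAfin using Set.Finite.induction_on with
  | empty =>
    have := hmarg he (Set.notMem_empty e)
    rw [insert_empty_eq, ρ.rk_empty] at this ⊢
    omega
  | @insert f A hfA hAfin ih =>
    have ih := ih ((Set.subset_insert _ _).trans hA)
    have hf := hA (Set.mem_insert f A)
    have heA : e ∉ insert f A := fun he' => (hA he').2 rfl
    have hef : e ≠ f := fun heq => hf.2 heq.symm
    have heA' : e ∉ A := fun h => heA (Set.mem_insert_of_mem f h)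
    refine (hmarg he heA).resolve_left fun hle => ?_
    -- Adding `f` lowers the marginal of `e` by the same amount, at least `k - 2 ≥ 2`, as adding `e`
    -- lowers that of `f`. So the marginal of `f` also falls from high to low, and the minor on `{e,
    -- f}` over `A` meets the hypotheses of `not_mem_of_pair`.
    have m1 := hmarg hf.1 hfA
    have m2 := hmarg hf.1 (A := insert e A) (by simp [hfA, hef.symm])
    rw [Set.insert_comm] at m2
    have hS : {e, f} ⊆ ρ.E := Set.insert_subset he (Set.singleton_subset_iff.2 hf.1)
    have hSA : Disjoint {e, f} A := by
      rw [Set.disjoint_left]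
      rintro x (rfl | rfl)
      exacts [heA', hfA]
    have hkσ : (ρ.restrictContract A {e, f}).IsKPolymatroid k := (h.1.contract A).delete _
    have mono1 := ρ.rk_mono (Set.subset_insert e A)
    have mono2 := ρ.rk_mono (Set.subset_insert f A)
    have mono3 := ρ.rk_mono (Set.subset_insert e (insert f A))
    have mono4 := ρ.rk_mono (Set.insert_subset_insert (a := e) (Set.subset_insert f A))
    have hke := hkσ e (by rw [restrictContract_ground hS hSA]; simp)
    have hkf := hkσ f (by rw [restrictContract_ground hS hSA]; simp)
    have re : (ρ.restrictContract A {e, f}).rk {e} = ρ.rk (insert e A) - ρ.rk A := by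
      rw [restrictContract_rk (by simp), Set.singleton_union]
    have rf : (ρ.restrictContract A {e, f}).rk {f} = ρ.rk (insert f A) - ρ.rk A := by
      rw [restrictContract_rk (by simp), Set.singleton_union]
    have ref : (ρ.restrictContract A {e, f}).rk {e, f} =
        ρ.rk (insert e (insert f A)) - ρ.rk A := by
      rw [restrictContract_rk Set.Subset.rfl, Set.insert_union, Set.singleton_union]
    rw [re] at hke
    rw [rf] at hkf
    refine not_mem_of_pair hEx hC hb hk hkσ hef (restrictContract_ground hS hSA) ?_ ?_ ?_ ?_
      (h.mem_restrictContract hS hSA ?_)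
    · omega
    · omega
    · omega
    · omega
    · rintro heq
      rw [← heq, Set.ncard_pair hef] at hE
      omega

theorem IsExcludedMinor.not_isMinor (h : ρ.IsExcludedMinor C k) (hC : C.MinorClosed) (he : e ∈ ρ.E)
    {N : Matroid (α × Fin k)} (hN : ¬ C.Mem N) :
    ¬ N.IsMinor ((ρ.naturalMatroid k).contract (Prod.fst ⁻¹' {e})) ∧
      ¬ N.IsMinor ((ρ.naturalMatroid k).delete (Prod.fst ⁻¹' {e})) := by
  have hne : ∀ σ : Polymatroid α, σ.E = ρ.E \ {e} → σ ≠ ρ := by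
    rintro σ hσ rfl
    rw [hσ] at he
    exact (hσ ▸ he).2 rfl
  constructor <;> intro hm <;> refine hN (hC ?_ hm)
  · rw [← h.1.naturalMatroid_contract]
    refine (h.2.2 _ ⟨⟨{e}, ∅, ?_⟩, hne _ rfl⟩).2
    simp [delete]
  · rw [← naturalMatroid_delete]
    refine (h.2.2 _ ⟨⟨∅, {e}, ?_⟩, hne _ rfl⟩).2
    simp [contract, ρ.rk_empty]

theorem IsExcludedMinor.ncard_ground_le (h : ρ.IsExcludedMinor C k) (hEx : C.ExcludesUniform b)
    (hC : C.MinorClosed) (hb : 4 ≤ b) (hk : 2 * b - 4 ≤ k) : ρ.E.ncard ≤ b := by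
  by_contra! hE
  have hM : ¬ C.Mem (ρ.naturalMatroid k) := fun hM => h.2.1 ⟨h.1, hM⟩
  obtain ⟨N, hNM, hN⟩ := MatroidClass.exists_isExcludedMinor (ρ.naturalMatroid_finite k) hM
  have hNb : N.E.ncard = b := by
    rcases (hEx _ N).1 hN with hiso | hiso
    exacts [hiso.ncard_eq_of_uniform, hiso.ncard_eq_of_uniform]
  have hmeet : ∀ e ∈ ρ.E, ∃ x ∈ N.E, x.1 = e := by
    intro e he
    by_contra! hcon
    have hdj : Disjoint (Prod.fst ⁻¹' {e}) N.E := Set.disjoint_left.2 fun x hx hxN => hcon x hxN hx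
    have hsub : Prod.fst ⁻¹' {e} ⊆ (ρ.naturalMatroid k).E :=
      Set.preimage_mono (Set.singleton_subset_iff.2 he)
    have hnot := h.not_isMinor hC he hN.2.1
    suffices hor : N.IsMinor ((ρ.naturalMatroid k).contract (Prod.fst ⁻¹' {e})) ∨
        N.IsMinor ((ρ.naturalMatroid k).delete (Prod.fst ⁻¹' {e})) from
      hor.elim hnot.1 hnot.2
    rcases Nat.lt_or_ge (ρ.rk {e}) 2 with hlt | hge
    · refine hNM.of_eRk_le_one hsub ?_ hdj
      rw [h.1.eRk_preimage (Set.singleton_subset_iff.2 he)]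
      exact_mod_cast Nat.le_of_lt_succ hlt
    · refine hNM.of_eRk_dual_le_one hsub (h.1.eRk_dual_preimage_singleton_le he ?_) hdj
      have := h.marginal_of_two_le hEx hC hb hk (by omega) he hge Set.Subset.rfl
      rw [Set.insert_sdiff_singleton, Set.insert_eq_of_mem he] at this
      omega
  have hNfin : N.E.Finite := (ρ.finite_preimage_ground k).subset hNM.subset
  have h1 : ρ.E ⊆ Prod.fst '' N.E := hmeet
  have h2 := Set.ncard_le_ncard h1 (hNfin.image _)
  have h3 := Set.ncard_image_le (f := Prod.fst) hNfin
  omega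

/-- `c` is the table of the rank function of `ρ` under some numbering of the ground set. -/
def HasTable (ρ : Polymatroid α) {n : ℕ} (c : Set (Fin n) → ℕ) : Prop :=
  ∃ f : ρ.E ≃ Fin n, ∀ A : Set ρ.E, ρ.rk (Subtype.val '' A) = c (f '' A)

theorem HasTable.iso {σ : Polymatroid β} {n : ℕ} {c : Set (Fin n) → ℕ} (h : ρ.HasTable c)
    (h' : σ.HasTable c) : ρ.Iso σ := by
  obtain ⟨f, hf⟩ := h
  obtain ⟨g, hg⟩ := h'
  refine ⟨f.trans g.symm, fun A => ?_⟩
  rw [hf, hg, ← Set.image_comp]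
  congr 2
  ext x
  simp

theorem exists_hasTable (ρ : Polymatroid α) : ∃ c : Set (Fin ρ.E.ncard) → ℕ, ρ.HasTable c := by
  have : Finite ρ.E := ρ.finite
  let f : ρ.E ≃ Fin ρ.E.ncard := Finite.equivFinOfCardEq rfl
  refine ⟨fun B => ρ.rk (Subtype.val '' (f.symm '' B)), f, fun A => ?_⟩
  simp only [Equiv.symm_image_image]

/-- A rank table determines a polymatroid up to isomorphism, and bounded size and rank leave
finitely many tables; one representative is chosen for each table that occurs. -/
theorem exists_finite_representatives (P : ∀ {α : Type u}, Polymatroid α → Prop) (n m : ℕ)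
    (hn : ∀ {α : Type u} (ρ : Polymatroid α), P ρ → ρ.E.ncard ≤ n)
    (hm : ∀ {α : Type u} (ρ : Polymatroid α), P ρ → ρ.rk ρ.E ≤ m) :
    ∃ S : Set (Σ α : Type u, Polymatroid α), S.Finite ∧ (∀ p ∈ S, P p.2) ∧
      ∀ (α : Type u) (ρ : Polymatroid α), P ρ → ∃ p ∈ S, ρ.Iso p.2 := by
  classical
  let T := Σ i : Fin (n + 1), (Set (Fin i) → Fin (m + 1))
  let Q : T → (Σ α : Type u, Polymatroid α) → Prop := fun t p =>
    P p.2 ∧ p.2.HasTable fun A => (t.2 A : ℕ)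
  let rep : {t : T // ∃ p, Q t p} → Σ α : Type u, Polymatroid α := fun t => t.2.choose
  refine ⟨Set.range rep, Set.finite_range rep, ?_, fun α ρ hρ => ?_⟩
  · rintro _ ⟨t, rfl⟩
    exact t.2.choose_spec.1
  · obtain ⟨c, hc⟩ := ρ.exists_hasTable
    have hcm : ∀ A, c A < m + 1 := fun A => by
      obtain ⟨f, hf⟩ := hc
      have h1 := hf (f.symm '' A)
      rw [Equiv.image_symm_image] at h1
      rw [← h1]
      refine Nat.lt_succ_of_le ((ρ.rk_mono ?_).trans (hm ρ hρ))
      rintro _ ⟨x, _, rfl⟩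
      exact x.2
    let t : T := ⟨⟨ρ.E.ncard, Nat.lt_succ_of_le (hn ρ hρ)⟩, fun A => ⟨c A, hcm A⟩⟩
    have ht : ∃ p, Q t p := ⟨⟨α, ρ⟩, hρ, hc⟩
    exact ⟨rep ⟨t, ht⟩, ⟨_, rfl⟩, HasTable.iso (c := c) hc ht.choose_spec.2⟩

end Polymatroid

/-- Let `b ≥ 4`, let `C` be the minor-closed matroid class whose excluded minors are (up to
isomorphism) `U_{2,b}` and `U_{b-2,b}`, and let `k ≥ 2b - 4`. Every excluded minor for the class of
`k`-polymatroids whose `k`-natural matroids are in `C` has at most `b` elements, and there are, up to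
isomorphism, only finitely many of them. -/
theorem mainTheorem1 (b k : ℕ) (hb : 4 ≤ b) (hk : 2 * b - 4 ≤ k)
    (C : MatroidClass.{u}) (hC : C.MinorClosed)
    (hEx : ∀ (α : Type u) (M : Matroid α), C.IsExcludedMinor M ↔
      (MatroidIso M (uniformMatroid 2 b) ∨ MatroidIso M (uniformMatroid (b - 2) b))) :
    (∀ (α : Type u) (ρ : Polymatroid α), ρ.IsExcludedMinor C k → ρ.E.ncard ≤ b) ∧
    ∃ S : Set (Σ α : Type u, Polymatroid α), S.Finite ∧
      (∀ p ∈ S, p.2.IsExcludedMinor C k) ∧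
      ∀ (α : Type u) (ρ : Polymatroid α), ρ.IsExcludedMinor C k → ∃ p ∈ S, ρ.Iso p.2 := by
  have hcard : ∀ {α : Type u} (ρ : Polymatroid α), ρ.IsExcludedMinor C k → ρ.E.ncard ≤ b :=
    fun ρ h => h.ncard_ground_le hEx hC hb hk
  -- The rank bound `b * k` comes from at most `b` elements, each of rank at most `k`.
  exact ⟨fun _ => hcard, Polymatroid.exists_finite_representatives
    (fun ρ => ρ.IsExcludedMinor C k) b (b * k) hcard fun ρ h =>
      (h.1.rk_le Set.Subset.rfl).trans (Nat.mul_le_mul_right k (hcard ρ h))⟩
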